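/- Let $N\ge 1$, let $c_1,\dots,c_N\in\mathbb{C}$ with $|c_n|=1$, let $u_1,\dots,u_N\in\mathbb{C}\setminus\{0\}$, and let $Z_1,\dots,Z_N$ be independent, zero-mean, circular complex Gaussian random variables of unit variance, i.e. for each $n$ the real and imaginary parts of $Z_n$ are independent real Gaussian variables with mean $0$ and variance $\tfrac12$. For an unknown constant $\gamma\in\mathbb{C}$ one observes $$Y_n = c_n\gamma + u_n Z_n,\qquad n=1,\dots,N .$$ An estimator is a measurable function $T$ of $Y=(Y_1,\dots,Y_N)$; it is an unbiased estimator of $g(\gamma)$ if, for every $\gamma\in\mathbb{C}$, $T(Y)$ is integrable and $\mathbb{E}_\gamma T(Y)=g(\gamma)$. The variance of a complex estimator is $\operatorname{Var}_\gamma(T)=\mathbb{E}_\gamma|T(Y)-\mathbb{E}_\gamma T(Y)|^2\in[0,\infty]$. An unbiased estimator of $\gamma$ is a uniformly minimum variance unbiased (UMVU) estimator if, for every $\gamma$, its variance is finite and is at most the variance of every unbiased estimator of $\gamma$. Put $$\beta=\Bigl(\sum_{n=1}^N|u_n|^{-2}\Bigr)^{-1},\qquad w_n=c_n^*\,\beta\,|u_n|^{-2},\qquad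 \hat\gamma=\sum_{n=1}^N w_nY_n .$$ Then: 1. $\hat\gamma$ is the UMVU estimator of $\gamma$: it is a UMVU estimator, and every UMVU estimator of $\gamma$ coincides with $\hat\gamma$ almost surely under every $\gamma\in\mathbb{C}$. 2. If $N\ge 2$, then $$\frac{1}{N-1}\sum_{n=1}^N |w_n|\,\bigl|Y_n-c_n\hat\gamma\bigr|^2$$ is an unbiased estimator of $\operatorname{Var}_\gamma(\hat\gamma)$. -/

import Mathlib

open MeasureTheory ProbabilityTheory
open scoped ENNReal NNReal ComplexConjugate

noncomputable section

/-- `Z` is a zero-mean circular complex Gaussian random variable with variance `v`: its real and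
imaginary parts are independent centred real Gaussians, each of variance `v / 2`. -/
structure IsCircularGaussian {Ω : Type*} [MeasurableSpace Ω] (Z : Ω → ℂ) (v : ℝ≥0)
    (μ : Measure Ω) : Prop where
  re_law : HasLaw (fun ω => (Z ω).re) (gaussianReal 0 (v / 2)) μ
  im_law : HasLaw (fun ω => (Z ω).im) (gaussianReal 0 (v / 2)) μ
  indep : IndepFun (fun ω => (Z ω).re) (fun ω => (Z ω).im) μ

section Estimation

variable {Θ 𝒴 F : Type*} [MeasurableSpace 𝒴] [NormedAddCommGroup F] [NormedSpace ℝ F]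
  [MeasurableSpace F]

/-- In the statistical model `(P θ)_θ` on the observation space `𝒴`, the statistic `T` is an
unbiased estimator of `g θ`: under every `P θ` it has an expectation, equal to `g θ`. -/
def IsUnbiasedEstimator (P : Θ → Measure 𝒴) (g : Θ → F) (T : 𝒴 → F) : Prop :=
  Measurable T ∧ ∀ θ, Integrable T (P θ) ∧ ∫ y, T y ∂(P θ) = g θ

/-- The variance `E |T - E T|²` of `T` under `P`, possibly infinite. -/
def statVariance (P : Measure 𝒴) (T : 𝒴 → F) : ℝ≥0∞ :=
  ∫⁻ y, ‖T y - ∫ z, T z ∂P‖ₑ ^ 2 ∂P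

/-- `T` is a uniformly minimum variance unbiased estimator of `g θ`: it is unbiased with finite
variance, and for every `θ` its variance is at most that of any unbiased estimator. -/
def IsUMVU (P : Θ → Measure 𝒴) (g : Θ → F) (T : 𝒴 → F) : Prop :=
  IsUnbiasedEstimator P g T ∧ (∀ θ, statVariance (P θ) T ≠ ∞) ∧
    ∀ S : 𝒴 → F, IsUnbiasedEstimator P g S → ∀ θ, statVariance (P θ) T ≤ statVariance (P θ) S

end Estimation

/-- The observations `Y_n = c_n γ + u_n Z_n`. -/
def observation {Ω : Type*} {N : ℕ} (c u : Fin N → ℂ) (Z : Fin N → Ω → ℂ) (γ : ℂ) (ω : Ω) :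
    Fin N → ℂ :=
  fun n => c n * γ + u n * Z n ω

/-- The statistical model: the law of the observation vector, for each value of `γ`. -/
def observationLaw {Ω : Type*} [MeasurableSpace Ω] {N : ℕ} (μ : Measure Ω) (c u : Fin N → ℂ)
    (Z : Fin N → Ω → ℂ) (γ : ℂ) : Measure (Fin N → ℂ) :=
  μ.map (observation c u Z γ)

/-- `β = (∑ |u_n|⁻²)⁻¹`. -/
def betaConst {N : ℕ} (u : Fin N → ℂ) : ℝ :=
  (∑ n, (‖u n‖ ^ 2)⁻¹)⁻¹

/-- `w_n = c_n^* β |u_n|⁻²`. -/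
def weight {N : ℕ} (c u : Fin N → ℂ) (n : Fin N) : ℂ :=
  conj (c n) * (betaConst u : ℂ) * (((‖u n‖ ^ 2)⁻¹ : ℝ) : ℂ)

/-- The weighted sum `γ̂ = ∑ w_n Y_n`, as a function of the observation vector. -/
def gammaHat {N : ℕ} (c u : Fin N → ℂ) (y : Fin N → ℂ) : ℂ :=
  ∑ n, weight c u n * y n

/-- `(N - 1)⁻¹ ∑ |w_n| |Y_n - c_n γ̂|²`, as a function of the observation vector. -/
def varianceEstimator {N : ℕ} (c u : Fin N → ℂ) (y : Fin N → ℂ) : ℝ :=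
  1 / ((N : ℝ) - 1) * ∑ n, ‖weight c u n‖ * ‖y n - c n * gammaHat c u y‖ ^ 2

end

/-! Let `l = ∑ w_n u_n z_n` be the estimation error of `gammaHat`, and let `S` be another unbiased
estimator. The difference `D = S - gammaHat` has mean zero under every parameter. Moving the
parameter by `k` translates the noise by `c_n k / u_n`, and the Gaussian translation density turns
the vanishing means of `D` into `∫ exp (Re (h l)) D = 0` for all complex `h`: the weights are such
that the exponent involves the noise only through `l` (`conj_shift_mul`). Differentiating at `h = 0`
shows that `D` is orthogonal to `l` in L² (`integral_noise_orthogonal`), and Pythagoras gives `Var S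
= E|D|² + Var gammaHat` whenever `Var S` is finite (`statVariance_eq_add`). Minimality and almost
sure uniqueness follow; completeness of a sufficient statistic is not needed.

For the variance estimator, expanding the squares gives `∑ |w_n| |Y_n - c_n γ̂|² = β ∑ |z_n|² -
|l|²` (`varianceEstimator_observation`), whose mean is `Nβ - β`, while `Var gammaHat = β`. -/

/-! ### Gaussian measures and the densities of their translates -/

/-- Translating a centred real Gaussian multiplies its density by an exponential. -/
theorem gaussianReal_map_add_eq_withDensity {v : ℝ≥0} (hv : v ≠ 0) (a : ℝ) :
    (gaussianReal 0 v).map (· + a) =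
      (gaussianReal 0 v).withDensity
        fun x => ENNReal.ofReal (Real.exp ((a * x - a ^ 2 / 2) / v)) := by
  rw [gaussianReal_map_add_const, gaussianReal_of_var_ne_zero _ hv,
    gaussianReal_of_var_ne_zero _ hv,
    ← withDensity_mul _ (measurable_gaussianPDF _ _) (by fun_prop)]
  congr 1
  ext x
  have hv' : (v : ℝ) ≠ 0 := by exact_mod_cast hv
  rw [Pi.mul_apply, gaussianPDF, gaussianPDF,
    ← ENNReal.ofReal_mul (gaussianPDFReal_nonneg _ _ _)]
  congr 1
  rw [gaussianPDFReal, gaussianPDFReal, mul_assoc (√(2 * Real.pi * v))⁻¹, ← Real.exp_add]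
  congr 2
  field_simp
  ring

/-- The law of a circular complex Gaussian variable of unit variance. -/
noncomputable def stdCircularGaussian : Measure ℂ :=
  ((gaussianReal 0 (1 / 2)).prod (gaussianReal 0 (1 / 2))).map Complex.measurableEquivRealProd.symm

instance : IsProbabilityMeasure stdCircularGaussian :=
  Measure.isProbabilityMeasure_map (by fun_prop)

theorem IsCircularGaussian.aemeasurable {Ω : Type*} [MeasurableSpace Ω] {Z : Ω → ℂ} {v : ℝ≥0}
    {μ : Measure Ω} (h : IsCircularGaussian Z v μ) : AEMeasurable Z μ := by
  have := Complex.measurableEquivRealProd.symm.measurable.comp_aemeasurable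
    (h.re_law.aemeasurable.prodMk h.im_law.aemeasurable)
  exact this

theorem IsCircularGaussian.map_eq {Ω : Type*} [MeasurableSpace Ω] {Z : Ω → ℂ}
    {μ : Measure Ω} [IsFiniteMeasure μ] (h : IsCircularGaussian Z 1 μ) :
    μ.map Z = stdCircularGaussian := by
  have key := (indepFun_iff_map_prod_eq_prod_map_map h.re_law.aemeasurable
    h.im_law.aemeasurable).1 h.indep
  rw [h.re_law.map_eq, h.im_law.map_eq] at key
  rw [stdCircularGaussian, ← key, AEMeasurable.map_map_of_aemeasurable (by fun_prop)
    (h.re_law.aemeasurable.prodMk h.im_law.aemeasurable)]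
  rfl

theorem isCircularGaussian_id : IsCircularGaussian id 1 stdCircularGaussian := by
  have hre : stdCircularGaussian.map (fun z => (id z).re) = gaussianReal 0 (1 / 2) := by
    rw [stdCircularGaussian, Measure.map_map (by fun_prop) (by fun_prop)]
    exact (Measure.map_fst_prod ..).trans (by simp)
  have him : stdCircularGaussian.map (fun z => (id z).im) = gaussianReal 0 (1 / 2) := by
    rw [stdCircularGaussian, Measure.map_map (by fun_prop) (by fun_prop)]
    exact (Measure.map_snd_prod ..).trans (by simp)
  refine ⟨⟨by fun_prop, hre⟩, ⟨by fun_prop, him⟩, ?_⟩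
  rw [indepFun_iff_map_prod_eq_prod_map_map (by fun_prop) (by fun_prop), hre, him,
    stdCircularGaussian, Measure.map_map (by fun_prop) (by fun_prop)]
  exact Measure.map_id

theorem lintegral_stdCircularGaussian {f : ℂ → ℝ≥0∞} (hf : Measurable f) :
    ∫⁻ z, f z ∂stdCircularGaussian =
      ∫⁻ x, ∫⁻ y, f ⟨x, y⟩ ∂gaussianReal 0 (1 / 2) ∂gaussianReal 0 (1 / 2) := by
  rw [stdCircularGaussian, lintegral_map hf (by fun_prop),
    lintegral_prod _ (by fun_prop)]
  rfl

theorem lintegral_gaussianReal_add {v : ℝ≥0} (hv : v ≠ 0) (a : ℝ) {f : ℝ → ℝ≥0∞}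
    (hf : Measurable f) :
    ∫⁻ x, f (x + a) ∂gaussianReal 0 v =
      ∫⁻ x, ENNReal.ofReal (Real.exp ((a * x - a ^ 2 / 2) / v)) * f x ∂gaussianReal 0 v := by
  rw [← lintegral_map (f := f) hf (by fun_prop), gaussianReal_map_add_eq_withDensity hv,
    lintegral_withDensity_eq_lintegral_mul _ (by fun_prop) hf]
  rfl

/-- The one-dimensional formula is applied to the imaginary and then to the real part by Tonelli;
the factor 2 comes from the variance 1/2 of each part. -/
theorem stdCircularGaussian_map_add_eq_withDensity (a : ℂ) :
    stdCircularGaussian.map (· + a) =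
      stdCircularGaussian.withDensity
        fun z => ENNReal.ofReal (Real.exp (2 * (conj a * z).re - ‖a‖ ^ 2)) := by
  refine Measure.ext_of_lintegral _ fun f hf => ?_
  have hmk : Measurable fun p : ℝ × ℝ => (⟨p.1, p.2⟩ : ℂ) :=
    Complex.measurableEquivRealProd.symm.measurable
  have hv : (1 / 2 : ℝ≥0) ≠ 0 := by simp
  rw [lintegral_map hf (by fun_prop), lintegral_withDensity_eq_lintegral_mul _ (by fun_prop) hf,
    lintegral_stdCircularGaussian (by fun_prop), lintegral_stdCircularGaussian (by fun_prop)]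
  have h1 : ∀ x : ℝ, ∫⁻ y, f (⟨x, y⟩ + a) ∂gaussianReal 0 (1 / 2) =
      ∫⁻ y, ENNReal.ofReal (Real.exp ((a.im * y - a.im ^ 2 / 2) / (1 / 2 : ℝ≥0))) *
        f ⟨x + a.re, y⟩ ∂gaussianReal 0 (1 / 2) := fun x =>
    lintegral_gaussianReal_add hv a.im (f := fun y => f ⟨x + a.re, y⟩)
      (hf.comp (hmk.comp measurable_prodMk_left))
  simp_rw [h1]
  have hF : Measurable fun p : ℝ × ℝ =>
      ENNReal.ofReal (Real.exp ((a.im * p.2 - a.im ^ 2 / 2) / (1 / 2 : ℝ≥0))) * f ⟨p.1, p.2⟩ :=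
    (by fun_prop : Measurable fun p : ℝ × ℝ =>
      ENNReal.ofReal (Real.exp ((a.im * p.2 - a.im ^ 2 / 2) / (1 / 2 : ℝ≥0)))).mul (hf.comp hmk)
  rw [lintegral_gaussianReal_add hv a.re (f := fun x => ∫⁻ y,
      ENNReal.ofReal (Real.exp ((a.im * y - a.im ^ 2 / 2) / (1 / 2 : ℝ≥0))) * f ⟨x, y⟩
        ∂gaussianReal 0 (1 / 2)) hF.lintegral_prod_right']
  refine lintegral_congr fun x => ?_
  have hFx := hF.comp (measurable_prodMk_left (x := x))
  simp only [Function.comp_def] at hFx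
  rw [← lintegral_const_mul _ hFx]
  refine lintegral_congr fun y => ?_
  rw [Pi.mul_apply, ← mul_assoc, ← ENNReal.ofReal_mul (Real.exp_nonneg _), ← Real.exp_add,
    Complex.sq_norm, Complex.normSq_apply]
  congr 3
  simp
  ring

/-- On a box, the product density times the indicator is a product of functions of single
coordinates, so independence factors its integral. -/
theorem pi_withDensity {ι : Type*} [Fintype ι] {X : ι → Type*} [∀ i, MeasurableSpace (X i)]
    (ν : ∀ i, Measure (X i)) [∀ i, IsProbabilityMeasure (ν i)] {f : ∀ i, X i → ℝ≥0∞}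
    (hf : ∀ i, Measurable (f i)) [∀ i, SigmaFinite ((ν i).withDensity (f i))] :
    Measure.pi (fun i => (ν i).withDensity (f i)) =
      (Measure.pi ν).withDensity fun x => ∏ i, f i (x i) := by
  refine Measure.pi_eq fun s hs => ?_
  rw [withDensity_apply _ (MeasurableSet.univ_pi hs),
    ← lintegral_indicator (MeasurableSet.univ_pi hs)]
  have h1 : ∀ x : ∀ i, X i, (Set.univ.pi s).indicator (fun x => ∏ i, f i (x i)) x =
      ∏ i, (s i).indicator (f i) (x i) := by
    intro x
    by_cases hx : x ∈ Set.univ.pi s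
    · rw [Set.indicator_of_mem hx]
      exact Finset.prod_congr rfl fun i _ => (Set.indicator_of_mem (hx i trivial) _).symm
    · rw [Set.indicator_of_notMem hx]
      simp only [Set.mem_pi, Set.mem_univ, true_implies, not_forall] at hx
      obtain ⟨i, hi⟩ := hx
      exact (Finset.prod_eq_zero (Finset.mem_univ i) (Set.indicator_of_notMem hi _)).symm
  have hm : ∀ i, Measurable ((s i).indicator (f i)) := fun i => (hf i).indicator (hs i)
  simp_rw [h1]
  rw [lintegral_prod_eq_prod_lintegral_of_indepFun Finset.univ
    (fun i (x : ∀ i, X i) => (s i).indicator (f i) (x i))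
    (iIndepFun_pi fun i => (hm i).aemeasurable) fun i => (hm i).comp (measurable_pi_apply i)]
  refine Finset.prod_congr rfl fun i _ => ?_
  rw [withDensity_apply _ (hs i), ← lintegral_indicator (hs i),
    ← (measurePreserving_eval ν i).lintegral_comp (hm i)]

/-- The law of a vector of independent standard circular complex Gaussians. -/
noncomputable def noiseLaw (ι : Type*) [Fintype ι] : Measure (ι → ℂ) :=
  Measure.pi fun _ => stdCircularGaussian

instance (ι : Type*) [Fintype ι] : IsProbabilityMeasure (noiseLaw ι) := by
  unfold noiseLaw; infer_instance

theorem noiseLaw_map_add_eq_withDensity {ι : Type*} [Fintype ι] (a : ι → ℂ) :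
    (noiseLaw ι).map (· + a) =
      (noiseLaw ι).withDensity fun z =>
        ENNReal.ofReal (Real.exp (2 * (∑ i, conj (a i) * z i).re - ∑ i, ‖a i‖ ^ 2)) := by
  -- Sigma-finiteness holds because the measure is a translate of a probability measure.
  have hS : ∀ i, SigmaFinite (stdCircularGaussian.withDensity
      fun z => ENNReal.ofReal (Real.exp (2 * (conj (a i) * z).re - ‖a i‖ ^ 2))) := by
    intro i
    rw [← stdCircularGaussian_map_add_eq_withDensity]
    have := Measure.isProbabilityMeasure_map (μ := stdCircularGaussian)
      (f := fun z => z + a i) (by fun_prop)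
    infer_instance
  have h1 := pi_withDensity (fun _ : ι => stdCircularGaussian)
    (f := fun i z => ENNReal.ofReal (Real.exp (2 * (conj (a i) * z).re - ‖a i‖ ^ 2)))
    (fun i => by fun_prop)
  have hS' : ∀ i, SigmaFinite (stdCircularGaussian.map (· + a i)) := by
    intro i
    rw [stdCircularGaussian_map_add_eq_withDensity]
    exact hS i
  have h2 := Measure.pi_map_pi (μ := fun _ : ι => stdCircularGaussian)
    (f := fun i z => z + a i) (fun i => by fun_prop)
  simp_rw [stdCircularGaussian_map_add_eq_withDensity] at h2
  rw [h1] at h2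
  refine h2.trans ?_
  rw [noiseLaw]
  congr 1
  ext z
  rw [← ENNReal.ofReal_prod_of_nonneg fun i _ => Real.exp_nonneg _, ← Real.exp_sum,
    Finset.sum_sub_distrib, ← Finset.mul_sum, Complex.re_sum]

/-! ### Moments of the noise and integrals under translation -/

theorem memLp_id_stdCircularGaussian : MemLp (fun z : ℂ => z) 2 stdCircularGaussian := by
  have hre : MemLp (fun z : ℂ => z.re) 2 stdCircularGaussian := by
    have h := memLp_id_gaussianReal (μ := 0) (v := 1 / 2) 2
    rw [← isCircularGaussian_id.re_law.map_eq] at h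
    exact h.comp_of_map (by fun_prop)
  have him : MemLp (fun z : ℂ => z.im) 2 stdCircularGaussian := by
    have h := memLp_id_gaussianReal (μ := 0) (v := 1 / 2) 2
    rw [← isCircularGaussian_id.im_law.map_eq] at h
    exact h.comp_of_map (by fun_prop)
  refine (hre.norm.add him.norm).of_le (by fun_prop) (Filter.Eventually.of_forall fun z => ?_)
  exact (Complex.norm_le_abs_re_add_abs_im z).trans (le_abs_self _)

theorem integral_id_stdCircularGaussian : ∫ z, z ∂stdCircularGaussian = 0 := by
  have hint := memLp_id_stdCircularGaussian.integrable (by norm_num)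
  have hre := isCircularGaussian_id.re_law.integral_eq
  have him := isCircularGaussian_id.im_law.integral_eq
  rw [integral_id_gaussianReal] at hre him
  apply Complex.ext
  · exact (integral_re hint).symm.trans hre
  · exact (integral_im hint).symm.trans him

theorem integral_sq_gaussianReal_zero (v : ℝ≥0) : ∫ x, x ^ 2 ∂gaussianReal 0 v = v := by
  have h := variance_fun_id_gaussianReal (μ := 0) (v := v)
  rwa [variance_of_integral_eq_zero (by fun_prop) integral_id_gaussianReal] at h

theorem integral_sq_norm_stdCircularGaussian : ∫ z, ‖z‖ ^ 2 ∂stdCircularGaussian = 1 := by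
  have h1 : ∀ z : ℂ, ‖z‖ ^ 2 = z.re ^ 2 + z.im ^ 2 := fun z => by
    rw [Complex.sq_norm, Complex.normSq_apply]; ring
  have hre : MemLp (fun z : ℂ => z.re) 2 stdCircularGaussian := memLp_id_stdCircularGaussian.re
  have him : MemLp (fun z : ℂ => z.im) 2 stdCircularGaussian := memLp_id_stdCircularGaussian.im
  simp_rw [h1]
  rw [integral_add hre.integrable_sq him.integrable_sq]
  have h2 := isCircularGaussian_id.re_law.integral_comp (f := fun x => x ^ 2) (by fun_prop)
  have h3 := isCircularGaussian_id.im_law.integral_comp (f := fun x => x ^ 2) (by fun_prop)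
  rw [integral_sq_gaussianReal_zero] at h2 h3
  simp only [Function.comp_def, id] at h2 h3
  rw [h2, h3]
  norm_num

section Noise

variable {ι : Type*} [Fintype ι]

theorem memLp_eval_noiseLaw (i : ι) : MemLp (fun z : ι → ℂ => z i) 2 (noiseLaw ι) :=
  memLp_id_stdCircularGaussian.comp_measurePreserving (measurePreserving_eval _ i)

theorem memLp_linear_noiseLaw (a : ι → ℂ) :
    MemLp (fun z : ι → ℂ => ∑ i, a i * z i) 2 (noiseLaw ι) :=
  memLp_finsetSum _ fun i _ => (memLp_eval_noiseLaw i).const_mul (a i)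

theorem integral_linear_noiseLaw (a : ι → ℂ) : ∫ z, ∑ i, a i * z i ∂noiseLaw ι = 0 := by
  rw [integral_finsetSum _ fun i _ =>
    ((memLp_eval_noiseLaw i).const_mul (a i)).integrable (by norm_num)]
  refine Finset.sum_eq_zero fun i _ => ?_
  rw [integral_const_mul, noiseLaw, integral_eval, integral_id_stdCircularGaussian, mul_zero]

theorem integral_sq_norm_eval_noiseLaw (i : ι) : ∫ z, ‖z i‖ ^ 2 ∂noiseLaw ι = 1 := by
  exact (integral_comp_eval (μ := fun _ : ι => stdCircularGaussian) (i := i)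
    (f := fun z : ℂ => ‖z‖ ^ 2) (by fun_prop)).trans integral_sq_norm_stdCircularGaussian

theorem integral_mul_conj_noiseLaw [DecidableEq ι] (i j : ι) :
    ∫ z, z i * conj (z j) ∂noiseLaw ι = if i = j then 1 else 0 := by
  split_ifs with h
  · subst h
    simp_rw [Complex.mul_conj']
    have := integral_sq_norm_eval_noiseLaw i
    exact_mod_cast (integral_ofReal (𝕜 := ℂ) (f := fun z : ι → ℂ => ‖z i‖ ^ 2)).trans
      (congrArg _ this)
  · have hind : IndepFun (fun z : ι → ℂ => z i) (fun z => z j) (noiseLaw ι) :=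
      (iIndepFun_pi (X := fun _ : ι => id) fun _ => aemeasurable_id).indepFun h
    have hind' : IndepFun (fun z : ι → ℂ => z i) (fun z => conj (z j)) (noiseLaw ι) :=
      hind.comp (φ := id) (ψ := fun w : ℂ => conj w) measurable_id (by fun_prop)
    rw [hind'.integral_fun_mul_eq_mul_integral (memLp_eval_noiseLaw i).1
      (memLp_eval_noiseLaw j).star.1, noiseLaw,
      integral_eval, integral_id_stdCircularGaussian, zero_mul]

/-- The square expands into a double sum whose off-diagonal terms vanish by independence and
centring. -/
theorem integral_sq_norm_linear_noiseLaw (a : ι → ℂ) :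
    ∫ z, ‖∑ i, a i * z i‖ ^ 2 ∂noiseLaw ι = ∑ i, ‖a i‖ ^ 2 := by
  classical
  have h1 : ∀ z : ι → ℂ, ((‖∑ i, a i * z i‖ ^ 2 : ℝ) : ℂ) =
      ∑ i, ∑ j, (a i * conj (a j)) * (z i * conj (z j)) := by
    intro z
    rw [Complex.ofReal_pow, ← Complex.mul_conj', map_sum, Finset.sum_mul_sum]
    refine Finset.sum_congr rfl fun i _ => Finset.sum_congr rfl fun j _ => ?_
    rw [map_mul]
    ring
  have hint : ∀ i j, Integrable (fun z : ι → ℂ => (a i * conj (a j)) * (z i * conj (z j)))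
      (noiseLaw ι) := fun i j =>
    ((memLp_eval_noiseLaw i).integrable_mul (memLp_eval_noiseLaw j).star).const_mul _
  apply Complex.ofReal_injective
  rw [← integral_complex_ofReal]
  simp_rw [h1]
  rw [integral_finsetSum _ fun i _ => integrable_finsetSum _ fun j _ => hint i j]
  simp_rw [integral_finsetSum _ fun j _ => hint _ j, integral_const_mul,
    integral_mul_conj_noiseLaw]
  simp [Complex.mul_conj']

/-- Change of variables for a translation of the noise. -/
theorem integral_add_noiseLaw (a : ι → ℂ) {f : (ι → ℂ) → ℂ} (hf : Measurable f) :
    ∫ z, f (z + a) ∂noiseLaw ι =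
      ∫ z, (Real.exp (2 * (∑ i, conj (a i) * z i).re - ∑ i, ‖a i‖ ^ 2) : ℂ) * f z
        ∂noiseLaw ι := by
  rw [← integral_map (φ := fun z => z + a) (f := f) (by fun_prop) (by fun_prop),
    noiseLaw_map_add_eq_withDensity,
    integral_withDensity_eq_integral_toReal_smul (by fun_prop) (by simp)]
  refine integral_congr_ae (Filter.Eventually.of_forall fun z => ?_)
  simp only [ENNReal.toReal_ofReal (Real.exp_nonneg _), Complex.real_smul]

/-- Up to a constant, the exponential is the density of the noise translated by `conj a / 2`, which
has total mass one. -/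
theorem integrable_exp_re_linear_noiseLaw (a : ι → ℂ) :
    Integrable (fun z : ι → ℂ => Real.exp (∑ i, a i * z i).re) (noiseLaw ι) := by
  set b : ι → ℂ := fun i => conj (a i) / 2 with hb
  set C : ℝ := ∑ i, ‖b i‖ ^ 2 with hC
  have h1 : Integrable (fun z : ι → ℂ => Real.exp (2 * (∑ i, conj (b i) * z i).re - C))
      (noiseLaw ι) := by
    refine ⟨(by fun_prop : Measurable _).aestronglyMeasurable, ?_⟩
    rw [hasFiniteIntegral_iff_ofReal (Filter.Eventually.of_forall fun z => Real.exp_nonneg _),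
      ← setLIntegral_univ, ← withDensity_apply _ MeasurableSet.univ,
      ← noiseLaw_map_add_eq_withDensity]
    have := Measure.isProbabilityMeasure_map (μ := noiseLaw ι)
      (f := fun z => z + b) (by fun_prop)
    exact measure_lt_top _ _
  refine (h1.const_mul (Real.exp C)).congr (Filter.Eventually.of_forall fun z => ?_)
  dsimp only
  rw [← Real.exp_add, add_sub_cancel, Complex.re_sum, Complex.re_sum, Finset.mul_sum]
  congr 1
  refine Finset.sum_congr rfl fun i _ => ?_
  have hbi : conj (b i) = a i / (2 : ℝ) := by simp [hb, map_ofNat]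
  rw [hbi, div_mul_eq_mul_div, Complex.div_ofReal_re]
  ring

end Noise

/-! ### Orthogonality in L² from orthogonality to exponentials -/

section Orthogonality

variable {X : Type*} [MeasurableSpace X] {Q : Measure X}

/-- A square-integrable `U` orthogonal to all the exponentials `exp (t W)` of a real random
variable `W` with exponential moments is orthogonal to `W`. -/
theorem integral_mul_eq_zero_of_integral_mul_exp [IsFiniteMeasure Q] {U : X → ℂ} {W : X → ℝ}
    (hU : MemLp U 2 Q) (hW : Measurable W)
    (hexp : ∀ t : ℝ, Integrable (fun x => Real.exp (t * W x)) Q)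
    (h0 : ∀ t : ℝ, ∫ x, (Real.exp (t * W x) : ℂ) * U x ∂Q = 0) :
    ∫ x, (W x : ℂ) * U x ∂Q = 0 := by
  -- For `|t| < 1` the `t`-derivative of `exp (t W)` is at most `exp (2|W|) ≤ B` in absolute value,
  -- and `B` is in L², so `B ‖U‖` is an integrable bound.
  set B : X → ℝ := fun x => Real.exp (2 * W x) + Real.exp (-2 * W x) with hB
  have hexp2 : ∀ t : ℝ, MemLp (fun x => Real.exp (t * W x)) 2 Q := fun t => by
    rw [memLp_two_iff_integrable_sq (by fun_prop)]
    refine (hexp (2 * t)).congr (Filter.Eventually.of_forall fun x => ?_)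
    dsimp only
    rw [← Real.exp_nat_mul]
    congr 1
    push_cast
    ring
  have hBL : MemLp B 2 Q := (hexp2 2).add (hexp2 (-2))
  have hUm := hU.aestronglyMeasurable
  have hderiv := (hasDerivAt_integral_of_dominated_loc_of_deriv_le (μ := Q) (𝕜 := ℝ)
    (x₀ := 0) (s := Metric.ball 0 1) (F := fun t x => (Real.exp (t * W x) : ℂ) * U x)
    (F' := fun t x => ((Real.exp (t * W x) * W x : ℝ) : ℂ) * U x)
    (bound := fun x => B x * ‖U x‖) (Metric.ball_mem_nhds 0 one_pos)
    (Filter.Eventually.of_forall fun t => by fun_prop) ?_ (by fun_prop) ?_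
    (hBL.integrable_mul hU.norm) ?_).2
  · simp_rw [h0] at hderiv
    have := hderiv.unique (hasDerivAt_const (0 : ℝ) (0 : ℂ))
    simpa using this
  · simpa using hU.integrable (by norm_num)
  · refine Filter.Eventually.of_forall fun x t ht => ?_
    rw [norm_mul, Complex.norm_real, Real.norm_eq_abs, abs_mul, Real.abs_exp]
    gcongr
    have ht' : |t| < 1 := by simpa using ht
    have h1 : |W x| ≤ Real.exp |W x| := by linarith [Real.add_one_le_exp |W x|]
    have h2 : t * W x ≤ |W x| := by
      calc t * W x ≤ |t * W x| := le_abs_self _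
        _ = |t| * |W x| := abs_mul _ _
        _ ≤ 1 * |W x| := by gcongr
        _ = |W x| := one_mul _
    calc Real.exp (t * W x) * |W x| ≤ Real.exp |W x| * Real.exp |W x| := by gcongr
      _ = Real.exp (2 * |W x|) := by rw [← Real.exp_add, two_mul]
      _ ≤ B x := by
        rcases abs_cases (W x) with ⟨h, _⟩ | ⟨h, _⟩
        · rw [h]; exact le_add_of_nonneg_right (Real.exp_nonneg _)
        · rw [h, mul_neg, ← neg_mul]; exact le_add_of_nonneg_left (Real.exp_nonneg _)
  · refine Filter.Eventually.of_forall fun x t _ => ?_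
    have h := (((hasDerivAt_id t).mul_const (W x)).exp).ofReal_comp.mul_const (U x)
    simpa using h

/-- A square-integrable `U` orthogonal to all the exponentials `exp (Re (h ℓ))` is orthogonal
to `ℓ`. -/
theorem integral_mul_conj_eq_zero_of_integral_mul_exp [IsFiniteMeasure Q] {U l : X → ℂ}
    (hU : MemLp U 2 Q) (hl : Measurable l) (hl2 : MemLp l 2 Q)
    (hexp : ∀ h : ℂ, Integrable (fun x => Real.exp (h * l x).re) Q)
    (h0 : ∀ h : ℂ, ∫ x, (Real.exp (h * l x).re : ℂ) * U x ∂Q = 0) :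
    ∫ x, U x * conj (l x) ∂Q = 0 := by
  have hre : ∫ x, ((l x).re : ℂ) * U x ∂Q = 0 := by
    refine integral_mul_eq_zero_of_integral_mul_exp hU (by fun_prop)
      (fun t => ?_) fun t => ?_
    · simpa using hexp t
    · simpa using h0 t
  have him : ∫ x, ((l x).im : ℂ) * U x ∂Q = 0 := by
    refine integral_mul_eq_zero_of_integral_mul_exp hU (by fun_prop)
      (fun t => ?_) fun t => ?_
    -- `Re (-t i l) = t Im l`.
    · simpa using hexp (-t * Complex.I)
    · simpa using h0 (-t * Complex.I)
  have h1 : ∀ x, U x * conj (l x) =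
      ((l x).re : ℂ) * U x - Complex.I * (((l x).im : ℂ) * U x) := by
    intro x
    have h2 : conj (l x) = ((l x).re : ℂ) - (l x).im * Complex.I := by
      apply Complex.ext <;> simp
    rw [h2]
    ring
  have hrel : MemLp (fun x => ((l x).re : ℂ)) 2 Q := hl2.re.ofReal
  have himl : MemLp (fun x => ((l x).im : ℂ)) 2 Q := hl2.im.ofReal
  simp_rw [h1]
  have i1 : Integrable (fun x => ((l x).re : ℂ) * U x) Q := hrel.integrable_mul hU
  have i2 : Integrable (fun x => ((l x).im : ℂ) * U x) Q := himl.integrable_mul hU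
  rw [integral_sub i1 (i2.const_mul _), integral_const_mul, hre, him]
  simp

theorem lintegral_enorm_sq_eq_ofReal_integral {f : X → ℂ} (hf : MemLp f 2 Q) :
    ∫⁻ x, ‖f x‖ₑ ^ 2 ∂Q = ENNReal.ofReal (∫ x, ‖f x‖ ^ 2 ∂Q) := by
  rw [ofReal_integral_eq_lintegral_ofReal ((memLp_two_iff_integrable_sq_norm hf.1).1 hf)
    (Filter.Eventually.of_forall fun x => by positivity)]
  refine lintegral_congr fun x => ?_
  rw [ENNReal.ofReal_pow (norm_nonneg _), ofReal_norm]

theorem memLp_two_of_lintegral_enorm_sq_ne_top {f : X → ℂ} (hf : AEStronglyMeasurable f Q)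
    (h : ∫⁻ x, ‖f x‖ₑ ^ 2 ∂Q ≠ ∞) : MemLp f 2 Q := by
  rw [memLp_two_iff_integrable_sq_norm hf]
  refine ⟨by fun_prop, ?_⟩
  rw [hasFiniteIntegral_iff_ofReal (Filter.Eventually.of_forall fun x => by positivity)]
  refine lt_of_le_of_lt (le_of_eq (lintegral_congr fun x => ?_)) h.lt_top
  rw [ENNReal.ofReal_pow (norm_nonneg _), ofReal_norm]

/-- Pythagoras' theorem in `L²`. -/
theorem lintegral_enorm_add_sq_of_orthogonal {U l : X → ℂ} (hU : MemLp U 2 Q) (hl : MemLp l 2 Q)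
    (h : ∫ x, U x * conj (l x) ∂Q = 0) :
    ∫⁻ x, ‖U x + l x‖ₑ ^ 2 ∂Q = ∫⁻ x, ‖U x‖ₑ ^ 2 ∂Q + ∫⁻ x, ‖l x‖ₑ ^ 2 ∂Q := by
  have hUl : Integrable (fun x => U x * conj (l x)) Q := hU.integrable_mul hl.star
  have hU2 := (memLp_two_iff_integrable_sq_norm hU.1).1 hU
  have hl2 := (memLp_two_iff_integrable_sq_norm hl.1).1 hl
  rw [lintegral_enorm_sq_eq_ofReal_integral (f := fun x => U x + l x) (hU.add hl),
    lintegral_enorm_sq_eq_ofReal_integral hU, lintegral_enorm_sq_eq_ofReal_integral hl,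
    ← ENNReal.ofReal_add (by positivity) (by positivity)]
  congr 1
  have h1 : ∀ x, ‖U x + l x‖ ^ 2 = ‖U x‖ ^ 2 + ‖l x‖ ^ 2 + 2 * (U x * conj (l x)).re := by
    intro x
    simp only [Complex.sq_norm, Complex.normSq_add]
  have hre : ∫ x, (U x * conj (l x)).re ∂Q = 0 := by
    have := integral_re hUl
    rw [h] at this
    simpa using this
  have hri : Integrable (fun x => (U x * conj (l x)).re) Q := hUl.re
  simp_rw [h1]
  have hs : Integrable (fun x => ‖U x‖ ^ 2 + ‖l x‖ ^ 2) Q := hU2.add hl2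
  rw [integral_add hs (hri.const_mul 2), integral_add hU2 hl2, integral_const_mul, hre]
  simp

end Orthogonality

/-! ### The observation model, the weights and the estimation error -/

section Model

variable {N : ℕ} (c u : Fin N → ℂ)

theorem observationLaw_eq_map_noiseLaw {Ω : Type*} [MeasurableSpace Ω] {μ : Measure Ω}
    [IsProbabilityMeasure μ] {Z : Fin N → Ω → ℂ} (hZ : ∀ n, IsCircularGaussian (Z n) 1 μ)
    (hindep : iIndepFun Z μ) (γ : ℂ) :
    observationLaw μ c u Z γ =
      (noiseLaw (Fin N)).map fun z n => c n * γ + u n * z n := by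
  have h := (iIndepFun_iff_map_fun_eq_pi_map fun n => (hZ n).aemeasurable).1 hindep
  simp_rw [(hZ _).map_eq] at h
  rw [noiseLaw, ← h, AEMeasurable.map_map_of_aemeasurable (Measurable.aemeasurable (by fun_prop))
    (aemeasurable_pi_lambda _ fun n => (hZ n).aemeasurable)]
  rfl

theorem measurable_gammaHat : Measurable (gammaHat c u) := by
  unfold gammaHat
  fun_prop

variable {c u}

theorem sum_inv_sq_norm_pos (hN : 1 ≤ N) (hu : ∀ n, u n ≠ 0) :
    0 < ∑ n, (‖u n‖ ^ 2)⁻¹ := by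
  have : Nonempty (Fin N) := ⟨⟨0, hN⟩⟩
  refine Finset.sum_pos (fun n _ => ?_) Finset.univ_nonempty
  have := norm_pos_iff.2 (hu n)
  positivity

theorem betaConst_pos (hN : 1 ≤ N) (hu : ∀ n, u n ≠ 0) : 0 < betaConst u :=
  inv_pos.2 (sum_inv_sq_norm_pos hN hu)

theorem norm_weight (hc : ∀ n, ‖c n‖ = 1) (n : Fin N) :
    ‖weight c u n‖ = betaConst u * (‖u n‖ ^ 2)⁻¹ := by
  have hβ : 0 ≤ betaConst u := inv_nonneg.2 (Finset.sum_nonneg fun n _ => by positivity)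
  rw [weight, norm_mul, norm_mul, RCLike.norm_conj, hc, one_mul, Complex.norm_real,
    Complex.norm_real, Real.norm_of_nonneg hβ, Real.norm_of_nonneg (by positivity)]

theorem weight_mul_self (hc : ∀ n, ‖c n‖ = 1) (n : Fin N) :
    weight c u n * c n = ((betaConst u * (‖u n‖ ^ 2)⁻¹ : ℝ) : ℂ) := by
  have h : conj (c n) * c n = 1 := by
    rw [Complex.conj_mul', hc]; simp
  rw [weight, Complex.ofReal_mul, mul_assoc, mul_assoc, mul_comm _ (c n), mul_left_comm _ (c n),
    ← mul_assoc, h, one_mul]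

theorem sum_weight_mul_self (hN : 1 ≤ N) (hc : ∀ n, ‖c n‖ = 1) (hu : ∀ n, u n ≠ 0) :
    ∑ n, weight c u n * c n = 1 := by
  simp_rw [weight_mul_self hc]
  rw [← Complex.ofReal_sum, ← Finset.mul_sum, betaConst,
    inv_mul_cancel₀ (sum_inv_sq_norm_pos hN hu).ne', Complex.ofReal_one]

/-- The estimation error of `gammaHat` is a linear function of the noise. -/
theorem gammaHat_observation (hN : 1 ≤ N) (hc : ∀ n, ‖c n‖ = 1) (hu : ∀ n, u n ≠ 0) (γ : ℂ)
    (z : Fin N → ℂ) :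
    gammaHat c u (fun n => c n * γ + u n * z n) = γ + ∑ n, weight c u n * u n * z n := by
  simp_rw [gammaHat, mul_add, Finset.sum_add_distrib, ← mul_assoc, ← Finset.sum_mul]
  rw [sum_weight_mul_self hN hc hu, one_mul]

theorem sum_sq_norm_weight_mul (hN : 1 ≤ N) (hc : ∀ n, ‖c n‖ = 1) (hu : ∀ n, u n ≠ 0) :
    ∑ n, ‖weight c u n * u n‖ ^ 2 = betaConst u := by
  have h1 : ∀ n, ‖weight c u n * u n‖ ^ 2 = betaConst u * (betaConst u * (‖u n‖ ^ 2)⁻¹) := by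
    intro n
    have := norm_pos_iff.2 (hu n)
    rw [norm_mul, norm_weight hc]
    field_simp
  simp_rw [h1]
  rw [← Finset.mul_sum, ← Finset.mul_sum]
  nth_rw 2 [betaConst]
  rw [inv_mul_cancel₀ (sum_inv_sq_norm_pos hN hu).ne', mul_one]

/-- Shifting the parameter by `h` amounts to a translation of the noise by `c n * h / u n`. -/
theorem observation_add (hu : ∀ n, u n ≠ 0) (γ h : ℂ) (z : Fin N → ℂ) :
    (fun n => c n * (γ + h) + u n * z n) =
      fun n => c n * γ + u n * (z + fun n => c n * h / u n) n := by
  ext n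
  have := hu n
  rw [Pi.add_apply]
  field_simp
  ring

/-- This is where the choice of weights enters: the linear form in the translation density is a
multiple of the estimation error, since `conj (c n) / conj (u n) = weight c u n * u n / β`. -/
theorem conj_shift_mul (hu : ∀ n, u n ≠ 0) (hN : 1 ≤ N) (h : ℂ) (z : Fin N → ℂ) :
    ∑ n, conj (c n * h / u n) * z n =
      conj h / betaConst u * ∑ n, weight c u n * u n * z n := by
  rw [Finset.mul_sum]
  refine Finset.sum_congr rfl fun n _ => ?_
  have hβ : (betaConst u : ℂ) ≠ 0 := by exact_mod_cast (betaConst_pos hN hu).ne'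
  have h1 := hu n
  have h2 : conj (u n) ≠ 0 := (map_ne_zero _).2 h1
  rw [weight, Complex.ofReal_inv, Complex.ofReal_pow, ← Complex.mul_conj', map_div₀, map_mul]
  field_simp

/-- An unbiased estimator of zero is uncorrelated with the error of `gammaHat`: its zero means at
the shifted parameters say that it is orthogonal to every `exp (Re (h l))`. -/
theorem integral_noise_orthogonal (hN : 1 ≤ N) (hu : ∀ n, u n ≠ 0)
    {D : (Fin N → ℂ) → ℂ} (hD : Measurable D)
    (h0 : ∀ γ : ℂ, ∫ z, D (fun n => c n * γ + u n * z n) ∂noiseLaw (Fin N) = 0) {γ : ℂ}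
    (hD2 : MemLp (fun z => D fun n => c n * γ + u n * z n) 2 (noiseLaw (Fin N))) :
    ∫ z, D (fun n => c n * γ + u n * z n) * conj (∑ n, weight c u n * u n * z n)
      ∂noiseLaw (Fin N) = 0 := by
  refine integral_mul_conj_eq_zero_of_integral_mul_exp hD2 (by fun_prop)
    (memLp_linear_noiseLaw _) (fun h => ?_) fun h => ?_
  · simp_rw [Finset.mul_sum, ← mul_assoc]
    exact integrable_exp_re_linear_noiseLaw _
  · have hβ : (betaConst u : ℂ) ≠ 0 := by exact_mod_cast (betaConst_pos hN hu).ne'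
    -- The shift is chosen so that `2 conj k / β = h`.
    set k : ℂ := conj h * betaConst u / 2 with hk
    have hk' : conj k / betaConst u = h / (2 : ℝ) := by
      have h2 : conj k = h * betaConst u / 2 := by simp [hk, map_ofNat]
      rw [h2]
      push_cast
      field_simp
    have h1 := h0 (γ + k)
    simp_rw [observation_add hu γ k] at h1
    rw [integral_add_noiseLaw (fun n => c n * k / u n)
      (f := fun z => D fun n => c n * γ + u n * z n) (by fun_prop)] at h1
    simp_rw [conj_shift_mul hu hN, hk', div_mul_eq_mul_div, Complex.div_ofReal_re,
      mul_div_cancel₀ _ (two_ne_zero (α := ℝ)), sub_eq_add_neg, Real.exp_add, Complex.ofReal_mul,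
      mul_right_comm _ (Complex.ofReal (Real.exp (-_)))] at h1
    -- The remaining factor `exp (-∑ |c n k / u n|²)` is constant in the noise and nonzero, so it
    -- cancels.
    rw [integral_mul_const] at h1
    exact (mul_eq_zero.1 h1).resolve_right
      (by exact_mod_cast (Real.exp_pos _).ne')

/-! ### Unbiasedness, minimality and uniqueness -/

theorem isUnbiasedEstimator_map {Θ X Y F : Type*} [MeasurableSpace X] [MeasurableSpace Y]
    [NormedAddCommGroup F] [NormedSpace ℝ F] [MeasurableSpace F] [BorelSpace F]
    [SecondCountableTopology F] {Q : Measure X} {φ : Θ → X → Y} (hφ : ∀ θ, Measurable (φ θ))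
    (g : Θ → F) (T : Y → F) :
    IsUnbiasedEstimator (fun θ => Q.map (φ θ)) g T ↔
      Measurable T ∧ ∀ θ, Integrable (fun x => T (φ θ x)) Q ∧ ∫ x, T (φ θ x) ∂Q = g θ := by
  refine and_congr_right fun hT => forall_congr' fun θ => ?_
  rw [integrable_map_measure hT.aestronglyMeasurable (hφ θ).aemeasurable,
    integral_map (hφ θ).aemeasurable hT.aestronglyMeasurable]
  rfl

theorem statVariance_map {Θ X Y : Type*} [MeasurableSpace X] [MeasurableSpace Y]
    {Q : Measure X} {φ : Θ → X → Y} (hφ : ∀ θ, Measurable (φ θ)) {g : Θ → ℂ} {T : Y → ℂ}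
    (hT : IsUnbiasedEstimator (fun θ => Q.map (φ θ)) g T) (θ : Θ) :
    statVariance (Q.map (φ θ)) T = ∫⁻ x, ‖T (φ θ x) - g θ‖ₑ ^ 2 ∂Q := by
  have := hT.1
  rw [statVariance, (hT.2 θ).2, lintegral_map (by fun_prop) (hφ θ)]

variable (c u) in
/-- The statistical model, as the family of images of the law of the noise. -/
noncomputable abbrev gaussianModel (γ : ℂ) : Measure (Fin N → ℂ) :=
  (noiseLaw (Fin N)).map fun z n => c n * γ + u n * z n

variable (c u) in
theorem measurable_observation_noise (γ : ℂ) :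
    Measurable fun (z : Fin N → ℂ) n => c n * γ + u n * z n := by
  fun_prop

theorem isUnbiasedEstimator_gammaHat (hN : 1 ≤ N) (hc : ∀ n, ‖c n‖ = 1) (hu : ∀ n, u n ≠ 0) :
    IsUnbiasedEstimator (gaussianModel c u) (fun γ : ℂ => γ) (gammaHat c u) := by
  refine (isUnbiasedEstimator_map (measurable_observation_noise c u) _ _).2
    ⟨measurable_gammaHat c u, fun γ => ?_⟩
  have hint := (memLp_linear_noiseLaw fun n => weight c u n * u n).integrable (by norm_num)
  simp_rw [gammaHat_observation hN hc hu]
  refine ⟨(integrable_const γ).add hint, ?_⟩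
  rw [integral_add (integrable_const γ) hint, integral_linear_noiseLaw]
  simp

theorem statVariance_gammaHat (hN : 1 ≤ N) (hc : ∀ n, ‖c n‖ = 1) (hu : ∀ n, u n ≠ 0) (γ : ℂ) :
    statVariance (gaussianModel c u γ) (gammaHat c u) = ENNReal.ofReal (betaConst u) := by
  rw [statVariance_map (measurable_observation_noise c u)
    (isUnbiasedEstimator_gammaHat hN hc hu) γ]
  simp_rw [gammaHat_observation hN hc hu, add_sub_cancel_left]
  rw [lintegral_enorm_sq_eq_ofReal_integral (memLp_linear_noiseLaw _),
    integral_sq_norm_linear_noiseLaw, sum_sq_norm_weight_mul hN hc hu]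

/-- The variance of an unbiased estimator exceeds that of `gammaHat` by the mean square of the
difference. -/
theorem statVariance_eq_add (hN : 1 ≤ N) (hc : ∀ n, ‖c n‖ = 1) (hu : ∀ n, u n ≠ 0)
    {S : (Fin N → ℂ) → ℂ} (hS : IsUnbiasedEstimator (gaussianModel c u) (fun γ : ℂ => γ) S) {γ : ℂ}
    (hfin : statVariance (gaussianModel c u γ) S ≠ ∞) :
    statVariance (gaussianModel c u γ) S =
      ∫⁻ y, ‖S y - gammaHat c u y‖ₑ ^ 2 ∂gaussianModel c u γ +
        statVariance (gaussianModel c u γ) (gammaHat c u) := by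
  have hφ := measurable_observation_noise c u
  have hγ := isUnbiasedEstimator_gammaHat hN hc hu
  have hSm := hS.1
  have hγm := hγ.1
  have hS' := (isUnbiasedEstimator_map hφ _ _).1 hS
  have hγ' := (isUnbiasedEstimator_map hφ _ _).1 hγ
  rw [statVariance_map hφ hS] at hfin
  rw [statVariance_map hφ hS, statVariance_map hφ hγ, lintegral_map (by fun_prop) (hφ γ)]
  have h1 := memLp_two_of_lintegral_enorm_sq_ne_top
    (Measurable.aestronglyMeasurable (by fun_prop)) hfin
  have hl := memLp_linear_noiseLaw fun n => weight c u n * u n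
  -- The difference of the estimators is `(S - γ) - l`; finite variance of `S` puts the first term
  -- in L².
  have hU : MemLp (fun z => S (fun n => c n * γ + u n * z n) -
      gammaHat c u fun n => c n * γ + u n * z n) 2 (noiseLaw (Fin N)) := by
    refine (h1.sub hl).ae_eq (Filter.Eventually.of_forall fun z => ?_)
    simp only [Pi.sub_apply, gammaHat_observation hN hc hu]
    ring
  have horth := integral_noise_orthogonal (D := fun y => S y - gammaHat c u y) hN hu (by fun_prop)
    (fun γ' => by
      rw [integral_sub (hS'.2 γ').1 (hγ'.2 γ').1, (hS'.2 γ').2, (hγ'.2 γ').2, sub_self]) hU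
  have := lintegral_enorm_add_sq_of_orthogonal hU hl horth
  simp_rw [gammaHat_observation hN hc hu, add_sub_cancel_left] at this ⊢
  rw [← this]
  refine lintegral_congr fun z => ?_
  rw [sub_add_eq_sub_sub, sub_add_cancel]

theorem isUMVU_gammaHat (hN : 1 ≤ N) (hc : ∀ n, ‖c n‖ = 1) (hu : ∀ n, u n ≠ 0) :
    IsUMVU (gaussianModel c u) (fun γ : ℂ => γ) (gammaHat c u) := by
  refine ⟨isUnbiasedEstimator_gammaHat hN hc hu, fun γ => ?_, fun S hS γ => ?_⟩
  · rw [statVariance_gammaHat hN hc hu]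
    exact ENNReal.ofReal_ne_top
  · by_cases hfin : statVariance (gaussianModel c u γ) S = ∞
    · rw [hfin]
      exact le_top
    · rw [statVariance_eq_add hN hc hu hS hfin]
      exact le_add_self

/-- Minimality of `T` forces its excess variance `E|T - gammaHat|²` to vanish, because the finite
variance of `gammaHat` can be cancelled. -/
theorem IsUMVU.ae_eq_gammaHat (hN : 1 ≤ N) (hc : ∀ n, ‖c n‖ = 1) (hu : ∀ n, u n ≠ 0)
    {T : (Fin N → ℂ) → ℂ} (hT : IsUMVU (gaussianModel c u) (fun γ : ℂ => γ) T) (γ : ℂ) :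
    T =ᵐ[gaussianModel c u γ] gammaHat c u := by
  have hTm := hT.1.1
  have hγm := measurable_gammaHat c u
  have h1 := hT.2.2 _ (isUnbiasedEstimator_gammaHat hN hc hu) γ
  rw [statVariance_eq_add hN hc hu hT.1 (hT.2.1 γ)] at h1
  have hfin : statVariance (gaussianModel c u γ) (gammaHat c u) ≠ ∞ :=
    (isUMVU_gammaHat hN hc hu).2.1 γ
  have h2 : ∫⁻ y, ‖T y - gammaHat c u y‖ₑ ^ 2 ∂gaussianModel c u γ = 0 :=
    nonpos_iff_eq_zero.1 (ENNReal.le_of_add_le_add_right hfin (by rwa [zero_add]))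
  rw [lintegral_eq_zero_iff (by fun_prop)] at h2
  filter_upwards [h2] with y hy
  simpa [sub_eq_zero] using hy

/-! ### The variance estimator -/

/-- The residual is `u n * z n - c n * l`. After weighting and summing, the squares give `β ∑ |z n|²
+ |l|²` and the cross terms give `-2|l|²`. -/
theorem varianceEstimator_observation (hN : 1 ≤ N) (hc : ∀ n, ‖c n‖ = 1) (hu : ∀ n, u n ≠ 0)
    (γ : ℂ) (z : Fin N → ℂ) :
    varianceEstimator c u (fun n => c n * γ + u n * z n) =
      1 / ((N : ℝ) - 1) * (betaConst u * ∑ n, ‖z n‖ ^ 2 -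
        ‖∑ n, weight c u n * u n * z n‖ ^ 2) := by
  rw [varianceEstimator, gammaHat_observation hN hc hu]
  congr 1
  set l := ∑ n, weight c u n * u n * z n with hl
  -- The coefficient `|w_n|` of `‖l‖ ^ 2` is written as `(w_n c_n).re` so that the sum can use `∑
  -- w_n c_n = 1`.
  have hterm : ∀ n, ‖weight c u n‖ * ‖c n * γ + u n * z n - c n * (γ + l)‖ ^ 2 =
      betaConst u * ‖z n‖ ^ 2 + (weight c u n * c n).re * ‖l‖ ^ 2
        - 2 * (weight c u n * u n * z n * conj l).re := by
    intro n
    have hn := norm_pos_iff.2 (hu n)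
    have h1 : c n * γ + u n * z n - c n * (γ + l) = u n * z n - c n * l := by ring
    have h2 : weight c u n * u n * z n * conj l =
        ((betaConst u * (‖u n‖ ^ 2)⁻¹ : ℝ) : ℂ) * (u n * z n * conj (c n * l)) := by
      rw [weight, map_mul]
      push_cast
      ring
    rw [h1, h2, Complex.re_ofReal_mul, norm_weight hc, weight_mul_self hc, Complex.ofReal_re]
    have h3 : ‖u n * z n - c n * l‖ ^ 2 =
        ‖u n‖ ^ 2 * ‖z n‖ ^ 2 + ‖l‖ ^ 2 - 2 * (u n * z n * conj (c n * l)).re := by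
      rw [Complex.sq_norm, Complex.normSq_sub, ← Complex.sq_norm, ← Complex.sq_norm, norm_mul,
        norm_mul, hc, one_mul, mul_pow]
    rw [h3]
    field_simp
  simp_rw [hterm, Finset.sum_sub_distrib, Finset.sum_add_distrib, ← Finset.mul_sum,
    ← Finset.sum_mul, ← Complex.re_sum]
  rw [sum_weight_mul_self hN hc hu, ← Finset.sum_mul, ← hl, Complex.mul_conj', Complex.one_re,
    ← Complex.ofReal_pow, Complex.ofReal_re]
  ring

theorem isUnbiasedEstimator_varianceEstimator (hN : 2 ≤ N) (hc : ∀ n, ‖c n‖ = 1)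
    (hu : ∀ n, u n ≠ 0) :
    IsUnbiasedEstimator (gaussianModel c u) (fun _ : ℂ => betaConst u)
      (varianceEstimator c u) := by
  have hN1 : 1 ≤ N := by omega
  have hγm := measurable_gammaHat c u
  refine (isUnbiasedEstimator_map (measurable_observation_noise c u) _ _).2
    ⟨by unfold varianceEstimator; fun_prop, fun γ => ?_⟩
  simp_rw [varianceEstimator_observation hN1 hc hu]
  have h1 : ∀ n, Integrable (fun z : Fin N → ℂ => ‖z n‖ ^ 2) (noiseLaw (Fin N)) := fun n =>
    (memLp_two_iff_integrable_sq_norm (memLp_eval_noiseLaw n).1).1 (memLp_eval_noiseLaw n)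
  have h2 := (integrable_finsetSum Finset.univ fun n _ => h1 n).const_mul (betaConst u)
  have hl := memLp_linear_noiseLaw fun n => weight c u n * u n
  have h3 := (memLp_two_iff_integrable_sq_norm hl.1).1 hl
  refine ⟨(h2.sub h3).const_mul _, ?_⟩
  rw [integral_const_mul, integral_sub h2 h3, integral_const_mul,
    integral_finsetSum _ fun n _ => h1 n, integral_sq_norm_linear_noiseLaw,
    sum_sq_norm_weight_mul hN1 hc hu]
  simp_rw [integral_sq_norm_eval_noiseLaw]
  have hN2 : (N : ℝ) - 1 ≠ 0 := by
    have : (2 : ℝ) ≤ N := by exact_mod_cast hN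
    linarith
  simp only [Finset.sum_const, Finset.card_univ, Fintype.card_fin, nsmul_eq_mul, mul_one]
  field_simp

end Model

theorem mainTheorem7 {Ω : Type*} [MeasurableSpace Ω] (μ : Measure Ω) [IsProbabilityMeasure μ]
    (N : ℕ) (hN : 1 ≤ N) (c u : Fin N → ℂ) (hc : ∀ n, ‖c n‖ = 1) (hu : ∀ n, u n ≠ 0)
    (Z : Fin N → Ω → ℂ) (hZ : ∀ n, IsCircularGaussian (Z n) 1 μ) (hindep : iIndepFun Z μ) :
    (IsUMVU (observationLaw μ c u Z) (fun γ : ℂ => γ) (gammaHat c u) ∧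
      ∀ T : (Fin N → ℂ) → ℂ, IsUMVU (observationLaw μ c u Z) (fun γ : ℂ => γ) T →
        ∀ γ : ℂ, T =ᵐ[observationLaw μ c u Z γ] gammaHat c u) ∧
    (2 ≤ N → IsUnbiasedEstimator (observationLaw μ c u Z)
      (fun γ : ℂ => (statVariance (observationLaw μ c u Z γ) (gammaHat c u)).toReal)
      (varianceEstimator c u)) := by
  have hmodel : observationLaw μ c u Z = gaussianModel c u :=
    funext (observationLaw_eq_map_noiseLaw c u hZ hindep)
  rw [hmodel]
  refine ⟨⟨isUMVU_gammaHat hN hc hu, fun T hT => hT.ae_eq_gammaHat hN hc hu⟩, fun hN2 => ?_⟩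
  simp_rw [statVariance_gammaHat hN hc hu, ENNReal.toReal_ofReal (betaConst_pos hN hu).le]
  exact isUnbiasedEstimator_varianceEstimator hN2 hc hu
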